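/- Let $\mathbb K$ be a field. A (multiplicative) Hom-Lie algebra $(L,\alpha_L)$ is a $\mathbb K$-vector space with a bilinear bracket and a linear map $\alpha_L\colon L\to L$ such that $[x,x]=0$ (equivalently, when $\operatorname{char}\mathbb K\neq 2$, $[x,y]=-[y,x]$), $\alpha_L[x,y]=[\alpha_L(x),\alpha_L(y)]$ and $[\alpha_L(x),[y,z]]+[\alpha_L(z),[x,y]]+[\alpha_L(y),[z,x]]=0$. Homomorphisms are linear maps preserving the bracket and the twist; an ideal is a subspace $H$ with $\alpha_L(H)\subseteq H$ and $[H,L]\subseteq H$. The centre is $Z(L)=\{x\in L\mid [\alpha_L^k(x),y]=0 \text{ for all } y\in L,\ k\ge 0\}$, and an ideal is central if it is contained in $Z(L)$. For ideals $H,K$, $[H,K]$ is the linear span of the brackets $[h,k]$ with $h\in H$, $k\in K$; $L$ is perfect if $L=[L,L]$. A central extension of $L$ is a surjective homomorphism $f\colon G\to L$ with $[\ker f,G]=0$. The non-abelian tensor square $L\star L$ is the quotient of $L\otimes L$ by the subspace spanned by the elements (a) $[m,m']\otimes\alpha_L(n)-\alpha_L(m)\otimes[m',n]+\alpha_L(m')\otimes[m,n]$,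 (b) $\alpha_L(m)\otimes[n,n']-[n',m]\otimes\alpha_L(n)+[n,m]\otimes\alpha_L(n')$, (c) $[n,m]\otimes[m,n]$, (d) $[n,m]\otimes[m',n']+[n',m']\otimes[m,n]$, (e) $[[n,m],[n',m']]\otimes\alpha_L([m'',n''])+[[n',m'],[n'',m'']]\otimes\alpha_L([m,n])+[[n'',m''],[n,m]]\otimes\alpha_L([m',n'])$, with twist induced by $\alpha_L\otimes\alpha_L$ and bracket $[m\star n,m'\star n']=-[n,m]\star[m',n']$. The non-abelian exterior square $L\curlywedge L$ is the quotient of $L\star L$ by the span of the elements $m\star m$, and $m\curlywedge n$ denotes the class of $m\star n$. The exterior centre of $L$ is $$Z_\alpha^{\curlywedge}(L)=\{l\in L\mid \alpha_L^k(l)\curlywedge x=0\text{ for all }x\in L,\ k\ge 0\},$$ and the epicentre is $Z_\alpha^{\ast}(L)=\bigcap f(Z(G))$, the intersection over all central extensions $f\colon G\to L$. The Schur multiplier is $\mathcal M(L)=(R\cap[F,F])/[F,R]$, where $0\to R\to F\to L\to 0$ is the canonical presentation of $L$ by the free Hom-Lie algebra on its underlying set. Theorem. Let $(L,\alpha_L)$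 be a perfect Hom-Lie algebra. (a) $Z_\alpha^{\curlywedge}(L)$ is the smallest central ideal of $L$ containing every central ideal $N$ of $L$ for which the canonical homomorphism $\mathcal M(L)\to\mathcal M(L/N)$ is injective. Moreover, for every central ideal $N$ of $L$ with projection $\pi\colon L\to L/N$, the canonical homomorphism $\pi\curlywedge\pi\colon L\curlywedge L\to (L/N)\curlywedge(L/N)$ is surjective, and $\mathcal M(L)\to\mathcal M(L/N)$ is injective if and only if $\pi\curlywedge\pi$ is an isomorphism. (b) $Z_\alpha^{\curlywedge}(L)=Z_\alpha^{\ast}(L)$. -/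

import Mathlib

open scoped TensorProduct

universe u v w x y

/-- A (multiplicative) Hom-Lie algebra over a field `K`: a vector space with a bilinear bracket and
a linear twist preserving the bracket, such that the Hom-Jacobi identity holds. Skew-symmetry is
written `[x, x] = 0`, which over a field of characteristic different from two is the same as
`[x, y] = -[y, x]` (see `bracket_skew` and `bracket_self_of_skew`). -/
structure HomLieAlgebra (K : Type u) [Field K] where
  carrier : Type v
  [addCommGroup : AddCommGroup carrier]
  [module : Module K carrier]
  bracket : carrier →ₗ[K] carrier →ₗ[K] carrier
  twist : carrier →ₗ[K] carrier
  bracket_self : ∀ x, bracket x x = 0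
  hom_jacobi : ∀ x y z, bracket (twist x) (bracket y z) + bracket (twist z) (bracket x y)
    + bracket (twist y) (bracket z x) = 0
  twist_bracket : ∀ x y, twist (bracket x y) = bracket (twist x) (twist y)

attribute [instance] HomLieAlgebra.addCommGroup HomLieAlgebra.module

namespace HomLieAlgebra

noncomputable section

variable {K : Type u} [Field K]

instance : CoeSort (HomLieAlgebra.{u, v} K) (Type v) := ⟨HomLieAlgebra.carrier⟩

theorem bracket_skew (L : HomLieAlgebra.{u, v} K) (x y : L) :
    L.bracket x y = -L.bracket y x := by
  have h := L.bracket_self (x + y)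
  simp only [map_add, LinearMap.add_apply, L.bracket_self, zero_add, add_zero] at h
  rw [eq_neg_iff_add_eq_zero, add_comm]
  exact h

theorem bracket_self_of_skew (hK : (2 : K) ≠ 0) {V : Type v} [AddCommGroup V] [Module K V]
    (B : V →ₗ[K] V →ₗ[K] V) (hB : ∀ x y, B x y = -B y x) (x : V) : B x x = 0 := by
  have h : (2 : K) • B x x = 0 := by
    rw [two_smul]; nth_rewrite 1 [hB x x]; simp
  exact (smul_eq_zero.mp h).resolve_left hK

/-! ### Homomorphisms -/

/-- Homomorphisms of Hom-Lie algebras. -/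
structure Hom (L : HomLieAlgebra.{u, v} K) (M : HomLieAlgebra.{u, w} K) where
  toLinearMap : L →ₗ[K] M
  map_bracket : ∀ x y, toLinearMap (L.bracket x y) = M.bracket (toLinearMap x) (toLinearMap y)
  map_twist : ∀ x, toLinearMap (L.twist x) = M.twist (toLinearMap x)

instance (L : HomLieAlgebra.{u, v} K) (M : HomLieAlgebra.{u, w} K) :
    CoeFun (Hom L M) (fun _ => L → M) := ⟨fun f => f.toLinearMap⟩

/-- Composition of homomorphisms. -/
def Hom.comp {L : HomLieAlgebra.{u, v} K} {M : HomLieAlgebra.{u, w} K}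
    {P : HomLieAlgebra.{u, x} K} (g : Hom M P) (f : Hom L M) : Hom L P where
  toLinearMap := g.toLinearMap ∘ₗ f.toLinearMap
  map_bracket x y := by simp [f.map_bracket, g.map_bracket]
  map_twist x := by simp [f.map_twist, g.map_twist]

theorem Hom.comp_apply {L : HomLieAlgebra.{u, v} K} {M : HomLieAlgebra.{u, w} K}
    {P : HomLieAlgebra.{u, x} K} (g : Hom M P) (f : Hom L M) (l : L) : g.comp f l = g (f l) := rfl

/-! ### Ideals -/

/-- Ideals of a Hom-Lie algebra. -/
@[ext]
structure HomIdeal (L : HomLieAlgebra.{u, v} K) where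
  toSubmodule : Submodule K L
  twist_mem : ∀ x ∈ toSubmodule, L.twist x ∈ toSubmodule
  bracket_mem : ∀ x ∈ toSubmodule, ∀ y : L, L.bracket x y ∈ toSubmodule

section Ideals

variable {L : HomLieAlgebra.{u, v} K}

instance : PartialOrder (HomIdeal L) :=
  PartialOrder.lift HomIdeal.toSubmodule (fun _ _ h => HomIdeal.ext h)

instance : Membership L (HomIdeal L) := ⟨fun I x => x ∈ I.toSubmodule⟩

theorem HomIdeal.bracket_mem_left (I : HomIdeal L) (y x : L) (hx : x ∈ I.toSubmodule) :
    L.bracket y x ∈ I.toSubmodule := by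
  rw [L.bracket_skew]
  exact I.toSubmodule.neg_mem (I.bracket_mem x hx y)

instance : Top (HomIdeal L) := ⟨⟨⊤, fun _ _ => trivial, fun _ _ _ => trivial⟩⟩

/-- Intersection of two ideals. -/
instance : Min (HomIdeal L) := ⟨fun I J =>
  { toSubmodule := I.toSubmodule ⊓ J.toSubmodule
    twist_mem := fun x hx => ⟨I.twist_mem x hx.1, J.twist_mem x hx.2⟩
    bracket_mem := fun x hx y => ⟨I.bracket_mem x hx.1 y, J.bracket_mem x hx.2 y⟩ }⟩

/-- The commutator `[L, I]` of the whole algebra with an ideal `I`: the linear span of all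
brackets `[x, y]` with `x ∈ L`, `y ∈ I`. -/
def commutator (I : HomIdeal L) : HomIdeal L where
  toSubmodule := Submodule.span K {z | ∃ x : L, ∃ y ∈ I, L.bracket x y = z}
  twist_mem z hz := by
    induction hz using Submodule.span_induction with
    | mem z h =>
      obtain ⟨x, y, hy, rfl⟩ := h
      rw [L.twist_bracket]
      exact Submodule.subset_span ⟨_, _, I.twist_mem y hy, rfl⟩
    | zero => simp
    | add a b _ _ ha hb => rw [map_add]; exact add_mem ha hb
    | smul c a _ ha => rw [map_smul]; exact Submodule.smul_mem _ c ha
  bracket_mem z hz w := by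
    induction hz using Submodule.span_induction with
    | mem z h =>
      obtain ⟨x, y, hy, rfl⟩ := h
      rw [L.bracket_skew]
      exact Submodule.neg_mem _
        (Submodule.subset_span ⟨w, _, I.bracket_mem_left x y hy, rfl⟩)
    | zero => simp
    | add a b _ _ ha hb => rw [map_add, LinearMap.add_apply]; exact add_mem ha hb
    | smul c a _ ha => rw [map_smul, LinearMap.smul_apply]; exact Submodule.smul_mem _ c ha

variable (L) in
/-- `L` is perfect when `L = [L, L]`. -/
def IsPerfect : Prop := commutator (⊤ : HomIdeal L) = ⊤

theorem iterate_twist_bracket (L : HomLieAlgebra.{u, v} K) (k : ℕ) (x y : L) :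
    (L.twist ^ k) (L.bracket x y) = L.bracket ((L.twist ^ k) x) ((L.twist ^ k) y) := by
  induction k with
  | zero => simp
  | succ k ih => rw [pow_succ', Module.End.mul_apply, ih, L.twist_bracket]; rfl

variable (L) in
/-- The centre `Z(L) = {x | [α^k x, y] = 0 for all y and all k ≥ 0}`. -/
def centre : HomIdeal L where
  toSubmodule :=
    { carrier := {x | ∀ (y : L) (k : ℕ), L.bracket ((L.twist ^ k) x) y = 0}
      add_mem' := fun ha hb y k => by
        rw [map_add, map_add, LinearMap.add_apply, ha y k, hb y k, add_zero]
      zero_mem' := fun y k => by simp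
      smul_mem' := fun c a ha y k => by
        rw [map_smul, map_smul, LinearMap.smul_apply, ha y k, smul_zero] }
  twist_mem x hx y k := by
    have h := hx y (k + 1)
    rwa [pow_succ, Module.End.mul_apply] at h
  bracket_mem x hx z y k := by
    rw [iterate_twist_bracket, hx, map_zero, LinearMap.zero_apply]

/-- The kernel of a homomorphism. -/
def Hom.ker {M : HomLieAlgebra.{u, w} K} (f : Hom L M) : HomIdeal L where
  toSubmodule := LinearMap.ker f.toLinearMap
  twist_mem x hx := by
    rw [LinearMap.mem_ker] at hx ⊢
    rw [f.map_twist, hx, map_zero]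
  bracket_mem x hx y := by
    rw [LinearMap.mem_ker] at hx ⊢
    rw [f.map_bracket, hx, map_zero, LinearMap.zero_apply]

/-- The preimage of an ideal under a homomorphism. -/
def HomIdeal.comap {M : HomLieAlgebra.{u, w} K} (f : Hom L M) (J : HomIdeal M) : HomIdeal L where
  toSubmodule := J.toSubmodule.comap f.toLinearMap
  twist_mem x hx := by
    rw [Submodule.mem_comap] at hx ⊢
    rw [f.map_twist]; exact J.twist_mem _ hx
  bracket_mem x hx y := by
    rw [Submodule.mem_comap] at hx ⊢
    rw [f.map_bracket]; exact J.bracket_mem _ hx _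

/-- An ideal, regarded as a Hom-Lie algebra. -/
def HomIdeal.toHomLie (I : HomIdeal L) : HomLieAlgebra.{u, v} K where
  carrier := I.toSubmodule
  bracket := LinearMap.mk₂ K
    (fun x y => (⟨L.bracket x y, I.bracket_mem x x.2 y⟩ : I.toSubmodule))
    (fun a b c => by ext; simp) (fun r a b => by ext; simp)
    (fun a b c => by ext; simp) (fun r a b => by ext; simp)
  twist := L.twist.restrict I.twist_mem
  bracket_self x := by ext; simp [L.bracket_self]
  hom_jacobi x y z := by ext; exact L.hom_jacobi x.1 y.1 z.1
  twist_bracket x y := by ext; exact L.twist_bracket x.1 y.1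

/-- The inclusion of an ideal. -/
def HomIdeal.incl (I : HomIdeal L) : Hom I.toHomLie L where
  toLinearMap := I.toSubmodule.subtype
  map_bracket _ _ := rfl
  map_twist _ := rfl

/-- The restriction of a homomorphism to ideals `I` and `J` with `f(I) ⊆ J`. -/
def Hom.restrict {M : HomLieAlgebra.{u, w} K} (f : Hom L M) (I : HomIdeal L) (J : HomIdeal M)
    (h : I ≤ J.comap f) : Hom I.toHomLie J.toHomLie where
  toLinearMap := f.toLinearMap.restrict (fun _ hx => h hx)
  map_bracket x y := Subtype.ext (f.map_bracket x.1 y.1)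
  map_twist x := Subtype.ext (f.map_twist x.1)

end Ideals

/-! ### Quotients -/

section Quotients

/-- The bilinear map induced by `B` on the quotient by a two-sided `B`-ideal. -/
def quotBracket {A : Type v} [AddCommGroup A] [Module K A] (I : Submodule K A)
    (B : A →ₗ[K] A →ₗ[K] A) (hl : ∀ a, ∀ x ∈ I, B a x ∈ I) (hr : ∀ x ∈ I, ∀ a, B x a ∈ I) :
    (A ⧸ I) →ₗ[K] (A ⧸ I) →ₗ[K] (A ⧸ I) :=
  (I.liftQ (I.liftQ (B.compr₂ I.mkQ) (fun x hx => by
      rw [LinearMap.mem_ker]; ext a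
      simpa using hr x hx a)).flip (fun x hx => by
      rw [LinearMap.mem_ker]; ext a
      simpa using hl a x hx)).flip

/-- The quotient of a vector space `A` with a bilinear bracket `B` and a linear map `t` by a
`t`-invariant two-sided ideal `I` modulo which the axioms of a Hom-Lie algebra hold. -/
def ofQuotient (A : Type v) [AddCommGroup A] [Module K A] (I : Submodule K A)
    (B : A →ₗ[K] A →ₗ[K] A) (t : A →ₗ[K] A)
    (hl : ∀ a, ∀ x ∈ I, B a x ∈ I) (hr : ∀ x ∈ I, ∀ a, B x a ∈ I) (ht : ∀ x ∈ I, t x ∈ I)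
    (hself : ∀ x, B x x ∈ I)
    (hjac : ∀ x y z, B (t x) (B y z) + B (t z) (B x y) + B (t y) (B z x) ∈ I)
    (hmul : ∀ x y, t (B x y) - B (t x) (t y) ∈ I) : HomLieAlgebra.{u, v} K where
  carrier := A ⧸ I
  bracket := quotBracket I B hl hr
  twist := I.mapQ I t ht
  bracket_self := by
    rintro ⟨x⟩
    exact (Submodule.Quotient.mk_eq_zero I).mpr (hself x)
  hom_jacobi := by
    rintro ⟨x⟩ ⟨y⟩ ⟨z⟩
    exact (Submodule.Quotient.mk_eq_zero I).mpr (hjac x y z)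
  twist_bracket := by
    rintro ⟨x⟩ ⟨y⟩
    exact (Submodule.Quotient.eq I).mpr (hmul x y)

variable {L : HomLieAlgebra.{u, v} K}

/-- The quotient of a Hom-Lie algebra by an ideal. -/
def quotient (L : HomLieAlgebra.{u, v} K) (I : HomIdeal L) : HomLieAlgebra.{u, v} K :=
  ofQuotient L I.toSubmodule L.bracket L.twist I.bracket_mem_left I.bracket_mem I.twist_mem
    (fun x => by rw [L.bracket_self]; exact I.toSubmodule.zero_mem)
    (fun x y z => by rw [L.hom_jacobi]; exact I.toSubmodule.zero_mem)
    (fun x y => by rw [L.twist_bracket, sub_self]; exact I.toSubmodule.zero_mem)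

/-- The canonical projection `L → L/I`. -/
def proj (I : HomIdeal L) : Hom L (L.quotient I) where
  toLinearMap := I.toSubmodule.mkQ
  map_bracket _ _ := rfl
  map_twist _ := rfl

/-- The homomorphism `L/I → M/J` induced by `f : L → M` with `f(I) ⊆ J`. -/
def quotientMap {M : HomLieAlgebra.{u, w} K} (I : HomIdeal L) (J : HomIdeal M) (f : Hom L M)
    (h : I ≤ J.comap f) : Hom (L.quotient I) (M.quotient J) where
  toLinearMap := I.toSubmodule.mapQ J.toSubmodule f.toLinearMap h
  map_bracket := by
    rintro ⟨x⟩ ⟨y⟩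
    exact congrArg J.toSubmodule.mkQ (f.map_bracket x y)
  map_twist := by
    rintro ⟨x⟩
    exact congrArg J.toSubmodule.mkQ (f.map_twist x)

end Quotients

/-! ### Non-abelian tensor and exterior squares -/

section TensorSquare

/-- The subspace `D(L, L)` of `L ⊗ L`, where `L` acts on itself by the bracket. -/
def tensorRel (L : HomLieAlgebra.{u, v} K) : Submodule K (L ⊗[K] L) :=
  Submodule.span K
    ({t | ∃ m m' n : L, t = L.bracket m m' ⊗ₜ[K] L.twist n - L.twist m ⊗ₜ[K] L.bracket m' n
        + L.twist m' ⊗ₜ[K] L.bracket m n} ∪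
      {t | ∃ m n n' : L, t = L.twist m ⊗ₜ[K] L.bracket n n' - L.bracket n' m ⊗ₜ[K] L.twist n
        + L.bracket n m ⊗ₜ[K] L.twist n'} ∪
      {t | ∃ m n : L, t = L.bracket n m ⊗ₜ[K] L.bracket m n} ∪
      {t | ∃ m m' n n' : L, t = L.bracket n m ⊗ₜ[K] L.bracket m' n'
        + L.bracket n' m' ⊗ₜ[K] L.bracket m n} ∪
      {t | ∃ m m' m'' n n' n'' : L, t =
        L.bracket (L.bracket n m) (L.bracket n' m') ⊗ₜ[K] L.twist (L.bracket m'' n'')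
        + L.bracket (L.bracket n' m') (L.bracket n'' m'') ⊗ₜ[K] L.twist (L.bracket m n)
        + L.bracket (L.bracket n'' m'') (L.bracket n m) ⊗ₜ[K] L.twist (L.bracket m' n')})

/-- The linear map `L ⊗ L → L`, `m ⊗ n ↦ [m, n]`. -/
def tensorToSelf (L : HomLieAlgebra.{u, v} K) : L ⊗[K] L →ₗ[K] L := TensorProduct.lift L.bracket

theorem tensorRel_le_ker (L : HomLieAlgebra.{u, v} K) :
    tensorRel L ≤ LinearMap.ker (tensorToSelf L) := by
  refine Submodule.span_le.mpr ?_
  rintro t ((((⟨m, m', n, rfl⟩ | ⟨m, n, n', rfl⟩) | ⟨m, n, rfl⟩) | ⟨m, m', n, n', rfl⟩) |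
      ⟨m, m', m'', n, n', n'', rfl⟩) <;>
    simp only [SetLike.mem_coe, LinearMap.mem_ker, tensorToSelf, map_add, map_sub,
      TensorProduct.lift.tmul]
  · have h := L.hom_jacobi m m' n
    rw [L.bracket_skew (L.twist n), L.bracket_skew n m, map_neg] at h
    rw [← neg_eq_zero, ← h]; abel
  · have h := L.hom_jacobi m n n'
    rw [L.bracket_skew (L.bracket n' m), L.bracket_skew (L.bracket n m), L.bracket_skew n m,
      map_neg, neg_neg, sub_neg_eq_add, ← h]; abel
  · rw [L.bracket_skew n m, map_neg, LinearMap.neg_apply, L.bracket_self, neg_zero]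
  · rw [L.bracket_skew n m, L.bracket_skew n' m', L.bracket_skew (-_)]
    simp
  · have h := L.hom_jacobi (L.bracket n m) (L.bracket n' m') (L.bracket n'' m'')
    rw [L.bracket_skew _ (L.twist (L.bracket m'' n'')), L.bracket_skew _ (L.twist (L.bracket m n)),
      L.bracket_skew _ (L.twist (L.bracket m' n')), L.bracket_skew m'' n'', L.bracket_skew m n,
      L.bracket_skew m' n']
    simp only [map_neg, LinearMap.neg_apply, neg_neg]
    rw [← h]; abel

theorem tensorToSelf_twist (L : HomLieAlgebra.{u, v} K) (t : L ⊗[K] L) :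
    tensorToSelf L (TensorProduct.map L.twist L.twist t) = L.twist (tensorToSelf L t) := by
  induction t with
  | zero => simp
  | add a b ha hb => simp only [map_add, ha, hb]
  | tmul m n => simp [tensorToSelf, L.twist_bracket]

/-- The bilinear bracket of `L ⊗ L`: on generators it is
`[m ⊗ n, m' ⊗ n'] = -[n, m] ⊗ [m', n']` (see `tensorBracket_tmul`). -/
def tensorBracket (L : HomLieAlgebra.{u, v} K) :
    L ⊗[K] L →ₗ[K] L ⊗[K] L →ₗ[K] L ⊗[K] L :=
  (TensorProduct.mk K L L).compl₁₂ (tensorToSelf L) (tensorToSelf L)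

theorem tensorBracket_tmul (L : HomLieAlgebra.{u, v} K) (m n m' n' : L) :
    tensorBracket L (m ⊗ₜ n) (m' ⊗ₜ n') = -(L.bracket n m ⊗ₜ[K] L.bracket m' n') := by
  rw [L.bracket_skew n m, TensorProduct.neg_tmul, neg_neg]
  rfl

theorem tensorBracket_apply (L : HomLieAlgebra.{u, v} K) (s t : L ⊗[K] L) :
    tensorBracket L s t = tensorToSelf L s ⊗ₜ[K] tensorToSelf L t := rfl

theorem map_mem_tensorRel {L : HomLieAlgebra.{u, v} K} {M : HomLieAlgebra.{u, w} K}
    (f : L →ₗ[K] M) (hb : ∀ x y, f (L.bracket x y) = M.bracket (f x) (f y))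
    (ht : ∀ x, f (L.twist x) = M.twist (f x)) :
    tensorRel L ≤ (tensorRel M).comap (TensorProduct.map f f) := by
  refine Submodule.span_le.mpr ?_
  rintro t ((((⟨m, m', n, rfl⟩ | ⟨m, n, n', rfl⟩) | ⟨m, n, rfl⟩) | ⟨m, m', n, n', rfl⟩) |
      ⟨m, m', m'', n, n', n'', rfl⟩) <;>
    simp only [SetLike.mem_coe, Submodule.mem_comap, map_add, map_sub, TensorProduct.map_tmul,
      hb, ht]
  · exact Submodule.subset_span (Or.inl (Or.inl (Or.inl (Or.inl ⟨_, _, _, rfl⟩))))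
  · exact Submodule.subset_span (Or.inl (Or.inl (Or.inl (Or.inr ⟨_, _, _, rfl⟩))))
  · exact Submodule.subset_span (Or.inl (Or.inl (Or.inr ⟨_, _, rfl⟩)))
  · exact Submodule.subset_span (Or.inl (Or.inr ⟨_, _, _, _, rfl⟩))
  · refine Submodule.subset_span (Or.inr ⟨f m, f m', f m'', f n, f n', f n'', ?_⟩)
    simp only [← hb, ← ht]

theorem tensorBracket_skew_mem (L : HomLieAlgebra.{u, v} K) (s t : L ⊗[K] L) :
    tensorBracket L s t + tensorBracket L t s ∈ tensorRel L := by
  induction s with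
  | zero => simp
  | add a b ha hb =>
    have e : tensorBracket L (a + b) t + tensorBracket L t (a + b)
        = (tensorBracket L a t + tensorBracket L t a)
          + (tensorBracket L b t + tensorBracket L t b) := by
      simp only [map_add, LinearMap.add_apply]; abel
    rw [e]; exact add_mem ha hb
  | tmul m n =>
    induction t with
    | zero => simp
    | add a b ha hb =>
      have e : tensorBracket L (m ⊗ₜ n) (a + b) + tensorBracket L (a + b) (m ⊗ₜ n)
          = (tensorBracket L (m ⊗ₜ n) a + tensorBracket L a (m ⊗ₜ n))
            + (tensorBracket L (m ⊗ₜ n) b + tensorBracket L b (m ⊗ₜ n)) := by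
        simp only [map_add, LinearMap.add_apply]; abel
      rw [e]; exact add_mem ha hb
    | tmul m' n' =>
      rw [tensorBracket_tmul, tensorBracket_tmul, ← neg_add]
      exact Submodule.neg_mem _ (Submodule.subset_span (Or.inl (Or.inr ⟨_, _, _, _, rfl⟩)))

theorem tensorBracket_self_mem (L : HomLieAlgebra.{u, v} K) (t : L ⊗[K] L) :
    tensorBracket L t t ∈ tensorRel L := by
  induction t with
  | zero => simp
  | add a b ha hb =>
    have e : tensorBracket L (a + b) (a + b) = tensorBracket L a a + tensorBracket L b b
        + (tensorBracket L a b + tensorBracket L b a) := by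
      simp only [map_add, LinearMap.add_apply]; abel
    rw [e]
    exact add_mem (add_mem ha hb) (tensorBracket_skew_mem L a b)
  | tmul m n =>
    rw [tensorBracket_tmul]
    exact Submodule.neg_mem _ (Submodule.subset_span (Or.inl (Or.inl (Or.inr ⟨_, _, rfl⟩))))

theorem tensorBracket_jacobi_mem (L : HomLieAlgebra.{u, v} K) (x y z : L ⊗[K] L) :
    tensorBracket L (TensorProduct.map L.twist L.twist x) (tensorBracket L y z)
      + tensorBracket L (TensorProduct.map L.twist L.twist z) (tensorBracket L x y)
      + tensorBracket L (TensorProduct.map L.twist L.twist y) (tensorBracket L z x)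
      ∈ tensorRel L := by
  have hψ : ∀ s t : L ⊗[K] L, tensorToSelf L (tensorBracket L s t)
      = L.bracket (tensorToSelf L s) (tensorToSelf L t) := fun _ _ => rfl
  have h1 : L.twist (tensorToSelf L x) ⊗ₜ[K] L.bracket (tensorToSelf L y) (tensorToSelf L z)
      - L.bracket (tensorToSelf L z) (tensorToSelf L x) ⊗ₜ[K] L.twist (tensorToSelf L y)
      + L.bracket (tensorToSelf L y) (tensorToSelf L x) ⊗ₜ[K] L.twist (tensorToSelf L z)
      ∈ tensorRel L :=
    Submodule.subset_span (Or.inl (Or.inl (Or.inl (Or.inr ⟨_, _, _, rfl⟩))))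
  have h2 := tensorBracket_skew_mem L (tensorBracket L z x) (TensorProduct.map L.twist L.twist y)
  have h3 := tensorBracket_skew_mem L (tensorBracket L x y) (TensorProduct.map L.twist L.twist z)
  rw [L.bracket_skew (tensorToSelf L y) (tensorToSelf L x), TensorProduct.neg_tmul] at h1
  have h := add_mem (add_mem h1 h2) h3
  simp only [tensorBracket_apply, tensorToSelf_twist] at h ⊢
  convert h using 1
  simp only [← tensorBracket_apply, hψ]
  abel

/-- The non-abelian tensor square `L ⋆ L`. -/
def tensorSquare (L : HomLieAlgebra.{u, v} K) : HomLieAlgebra.{u, v} K :=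
  ofQuotient (L ⊗[K] L) (tensorRel L) (tensorBracket L) (TensorProduct.map L.twist L.twist)
    (fun a x hx => by
      rw [tensorBracket_apply, LinearMap.mem_ker.mp (tensorRel_le_ker L hx), TensorProduct.tmul_zero]
      exact Submodule.zero_mem _)
    (fun x hx a => by
      rw [tensorBracket_apply, LinearMap.mem_ker.mp (tensorRel_le_ker L hx), TensorProduct.zero_tmul]
      exact Submodule.zero_mem _)
    (fun _ hx => map_mem_tensorRel L.twist L.twist_bracket (fun _ => rfl) hx)
    (tensorBracket_self_mem L) (tensorBracket_jacobi_mem L)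
    (fun x y => by
      simp only [tensorBracket_apply, tensorToSelf_twist, TensorProduct.map_tmul, sub_self]
      exact Submodule.zero_mem _)

/-- The class `m ⋆ n` of `m ⊗ n`. -/
def star {L : HomLieAlgebra.{u, v} K} (m n : L) : tensorSquare L :=
  (tensorRel L).mkQ (m ⊗ₜ[K] n)

/-- The homomorphism `L ⋆ L → M ⋆ M` induced by `f : L → M`. -/
def tensorMap {L : HomLieAlgebra.{u, v} K} {M : HomLieAlgebra.{u, w} K} (f : Hom L M) :
    Hom (tensorSquare L) (tensorSquare M) where
  toLinearMap := (tensorRel L).mapQ (tensorRel M) (TensorProduct.map f.toLinearMap f.toLinearMap)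
    (map_mem_tensorRel f.toLinearMap f.map_bracket f.map_twist)
  map_bracket := by
    have hf : ∀ t, tensorToSelf M (TensorProduct.map f.toLinearMap f.toLinearMap t)
        = f (tensorToSelf L t) := by
      intro t
      induction t with
      | zero => simp
      | add a b ha hb => simp only [map_add, ha, hb]
      | tmul m n => simp [tensorToSelf, f.map_bracket]
    rintro ⟨x⟩ ⟨y⟩
    refine congrArg (tensorRel M).mkQ ?_
    rw [tensorBracket_apply, TensorProduct.map_tmul, tensorBracket_apply, hf, hf]
  map_twist := by
    rintro ⟨x⟩
    refine congrArg (tensorRel M).mkQ ?_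
    rw [← LinearMap.comp_apply, ← LinearMap.comp_apply, ← TensorProduct.map_comp,
      ← TensorProduct.map_comp]
    have e : f.toLinearMap ∘ₗ L.twist = M.twist ∘ₗ f.toLinearMap := LinearMap.ext f.map_twist
    rw [e]

/-- The homomorphism `L ⋆ L → L`, `m ⋆ n ↦ [m, n]`. -/
def tensorTheta (L : HomLieAlgebra.{u, v} K) : Hom (tensorSquare L) L where
  toLinearMap := (tensorRel L).liftQ (tensorToSelf L) (tensorRel_le_ker L)
  map_bracket := by rintro ⟨x⟩ ⟨y⟩; rfl
  map_twist := by rintro ⟨x⟩; exact tensorToSelf_twist L x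

theorem tensorSquare_bracket (L : HomLieAlgebra.{u, v} K) (s t : tensorSquare L) :
    (tensorSquare L).bracket s t = star (tensorTheta L s) (tensorTheta L t) := by
  obtain ⟨x⟩ := s
  obtain ⟨y⟩ := t
  rfl

/-- The ideal `L □ L` of `L ⋆ L`: the linear span of the elements `m ⋆ m`. -/
def box (L : HomLieAlgebra.{u, v} K) : HomIdeal (tensorSquare L) where
  toSubmodule := Submodule.span K {t | ∃ m n : L, m = n ∧ t = star m n}
  twist_mem t ht := by
    induction ht using Submodule.span_induction with
    | mem t h =>
      obtain ⟨m, _, rfl, rfl⟩ := h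
      exact Submodule.subset_span ⟨L.twist m, _, rfl, rfl⟩
    | zero => simp
    | add a b _ _ ha hb => rw [map_add]; exact add_mem ha hb
    | smul c a _ ha => rw [map_smul]; exact Submodule.smul_mem _ c ha
  bracket_mem t ht y := by
    induction ht using Submodule.span_induction with
    | mem t h =>
      obtain ⟨m, _, rfl, rfl⟩ := h
      have e : tensorTheta L (star m m) = 0 := L.bracket_self m
      rw [tensorSquare_bracket, e, star, TensorProduct.zero_tmul, map_zero]
      exact Submodule.zero_mem _
    | zero => simp
    | add a b _ _ ha hb => rw [map_add, LinearMap.add_apply]; exact add_mem ha hb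
    | smul c a _ ha => rw [map_smul, LinearMap.smul_apply]; exact Submodule.smul_mem _ c ha

/-- The non-abelian exterior square `L ⋏ L = (L ⋆ L) / (L □ L)`. -/
def exteriorSquare (L : HomLieAlgebra.{u, v} K) : HomLieAlgebra.{u, v} K :=
  (tensorSquare L).quotient (box L)

/-- The class `m ⋏ n` of `m ⋆ n`. -/
def wedge {L : HomLieAlgebra.{u, v} K} (m n : L) : exteriorSquare L := proj (box L) (star m n)

/-- The homomorphism `f ⋏ f : L ⋏ L → M ⋏ M`, `m ⋏ n ↦ f m ⋏ f n`. -/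
def exteriorMap {L : HomLieAlgebra.{u, v} K} {M : HomLieAlgebra.{u, w} K} (f : Hom L M) :
    Hom (exteriorSquare L) (exteriorSquare M) :=
  quotientMap (box L) (box M) (tensorMap f) (by
    refine Submodule.span_le.mpr ?_
    rintro _ ⟨m, _, rfl, rfl⟩
    exact Submodule.subset_span ⟨f m, _, rfl, rfl⟩)

theorem exteriorMap_wedge {L : HomLieAlgebra.{u, v} K} {M : HomLieAlgebra.{u, w} K}
    (f : Hom L M) (m n : L) : exteriorMap f (wedge m n) = wedge (f m) (f n) := rfl

/-- The homomorphism `θ : L ⋏ L → L`, `m ⋏ n ↦ [m, n]`. -/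
def exteriorTheta (L : HomLieAlgebra.{u, v} K) : Hom (exteriorSquare L) L where
  toLinearMap := (box L).toSubmodule.liftQ (tensorTheta L).toLinearMap (by
    refine Submodule.span_le.mpr ?_
    rintro _ ⟨m, _, rfl, rfl⟩
    exact L.bracket_self m)
  map_bracket := by rintro ⟨x⟩ ⟨y⟩; exact (tensorTheta L).map_bracket x y
  map_twist := by rintro ⟨x⟩; exact (tensorTheta L).map_twist x

theorem exteriorTheta_wedge (L : HomLieAlgebra.{u, v} K) (m n : L) :
    exteriorTheta L (wedge m n) = L.bracket m n := rfl

theorem wedge_add_left {L : HomLieAlgebra.{u, v} K} (a b x : L) :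
    wedge (a + b) x = wedge a x + wedge b x := by
  rw [wedge, star, TensorProduct.add_tmul, map_add]
  exact map_add (proj (box L)).toLinearMap _ _

theorem wedge_smul_left {L : HomLieAlgebra.{u, v} K} (c : K) (a x : L) :
    wedge (c • a) x = c • wedge a x := by
  rw [wedge, star, ← TensorProduct.smul_tmul', map_smul]
  exact map_smul (proj (box L)).toLinearMap _ _

theorem wedge_zero_left {L : HomLieAlgebra.{u, v} K} (x : L) : wedge 0 x = 0 := by
  rw [wedge, star, TensorProduct.zero_tmul, map_zero]
  exact map_zero (proj (box L)).toLinearMap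

/-- The exterior centre `{l | α^k l ⋏ x = 0 for all x and all k ≥ 0}`. -/
def exteriorCentre (L : HomLieAlgebra.{u, v} K) : HomIdeal L where
  toSubmodule :=
    { carrier := {l | ∀ (x : L) (k : ℕ), wedge ((L.twist ^ k) l) x = 0}
      add_mem' := fun ha hb x k => by rw [map_add, wedge_add_left, ha x k, hb x k, add_zero]
      zero_mem' := fun x k => by rw [map_zero, wedge_zero_left]
      smul_mem' := fun c a ha x k => by rw [map_smul, wedge_smul_left, ha x k, smul_zero] }
  twist_mem l hl x k := by
    have h := hl x (k + 1)
    rwa [pow_succ, Module.End.mul_apply] at h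
  bracket_mem l hl y x k := by
    rw [iterate_twist_bracket, ← exteriorTheta_wedge, hl, map_zero, wedge_zero_left]

end TensorSquare

/-! ### Free Hom-Lie algebras and the Schur multiplier -/

section Free

/-- The underlying space of a Hom-Lie algebra with the bracket as (non-associative)
multiplication. -/
def BracketRing (L : HomLieAlgebra.{u, v} K) : Type v := L

instance (L : HomLieAlgebra.{u, v} K) : NonUnitalNonAssocRing (BracketRing L) :=
  { (inferInstanceAs (AddCommGroup L) : AddCommGroup (BracketRing L)) with
    mul := fun x y => L.bracket x y
    left_distrib := fun x y z => (L.bracket x).map_add y z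
    right_distrib := fun x y z => LinearMap.map_add₂ L.bracket x y z
    zero_mul := fun x => LinearMap.map_zero₂ L.bracket x
    mul_zero := fun x => (L.bracket x).map_zero }

instance (L : HomLieAlgebra.{u, v} K) : Module K (BracketRing L) :=
  inferInstanceAs (Module K L)

instance (L : HomLieAlgebra.{u, v} K) : IsScalarTower K (BracketRing L) (BracketRing L) :=
  ⟨fun c x y => LinearMap.map_smul₂ L.bracket c x y⟩

instance (L : HomLieAlgebra.{u, v} K) : SMulCommClass K (BracketRing L) (BracketRing L) :=
  ⟨fun c x y => ((L.bracket x).map_smul c y).symm⟩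

variable (K) {X : Type w} (a : X → X)

/-- The endomorphism of the free non-associative algebra on `X` extending `a : X → X`. -/
def freeTwist : FreeNonUnitalNonAssocAlgebra K X →ₙₐ[K] FreeNonUnitalNonAssocAlgebra K X :=
  FreeNonUnitalNonAssocAlgebra.lift K (fun x => FreeNonUnitalNonAssocAlgebra.of K (a x))

/-- The relations `x x = 0` and Hom-Jacobi, closed under left and right multiplication. -/
inductive FreeRel : FreeNonUnitalNonAssocAlgebra K X → Prop
  | mul_self (p : FreeNonUnitalNonAssocAlgebra K X) : FreeRel (p * p)
  | jacobi (p q r : FreeNonUnitalNonAssocAlgebra K X) :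
      FreeRel (freeTwist K a p * (q * r) + freeTwist K a r * (p * q) + freeTwist K a q * (r * p))
  | mul_left (p q : FreeNonUnitalNonAssocAlgebra K X) : FreeRel q → FreeRel (p * q)
  | mul_right (p q : FreeNonUnitalNonAssocAlgebra K X) : FreeRel q → FreeRel (q * p)

/-- The two-sided ideal of the free non-associative algebra generated by the relations. -/
def freeIdeal : Submodule K (FreeNonUnitalNonAssocAlgebra K X) :=
  Submodule.span K {p | FreeRel K a p}

theorem freeTwist_freeRel (p : FreeNonUnitalNonAssocAlgebra K X) (hp : FreeRel K a p) :
    FreeRel K a (freeTwist K a p) := by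
  induction hp with
  | mul_self p => rw [map_mul]; exact FreeRel.mul_self _
  | jacobi p q r => simp only [map_add, map_mul]; exact FreeRel.jacobi _ _ _
  | mul_left p q _ ih => rw [map_mul]; exact FreeRel.mul_left _ _ ih
  | mul_right p q _ ih => rw [map_mul]; exact FreeRel.mul_right _ _ ih

/-- The free Hom-Lie algebra on the set `X` with endomorphism `a`. -/
def free : HomLieAlgebra.{u, max u w} K :=
  ofQuotient (FreeNonUnitalNonAssocAlgebra K X) (freeIdeal K a)
    (LinearMap.mul K (FreeNonUnitalNonAssocAlgebra K X))
    (freeTwist K a : FreeNonUnitalNonAssocAlgebra K X →ₗ[K] FreeNonUnitalNonAssocAlgebra K X)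
    (fun p q hq => by
      induction hq using Submodule.span_induction with
      | mem q h => exact Submodule.subset_span (FreeRel.mul_left p q h)
      | zero => rw [map_zero]; exact Submodule.zero_mem _
      | add q r _ _ hq hr => rw [map_add]; exact add_mem hq hr
      | smul c q _ hq => rw [map_smul]; exact Submodule.smul_mem _ c hq)
    (fun q hq p => by
      induction hq using Submodule.span_induction with
      | mem q h => exact Submodule.subset_span (FreeRel.mul_right p q h)
      | zero => rw [map_zero]; exact Submodule.zero_mem _
      | add q r _ _ hq hr => rw [map_add]; exact add_mem hq hr
      | smul c q _ hq => rw [map_smul]; exact Submodule.smul_mem _ c hq)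
    (fun q hq => by
      induction hq using Submodule.span_induction with
      | mem q h => exact Submodule.subset_span (freeTwist_freeRel K a q h)
      | zero => rw [map_zero]; exact Submodule.zero_mem _
      | add q r _ _ hq hr => rw [map_add]; exact add_mem hq hr
      | smul c q _ hq => rw [map_smul]; exact Submodule.smul_mem _ c hq)
    (fun p => Submodule.subset_span (FreeRel.mul_self p))
    (fun p q r => Submodule.subset_span (FreeRel.jacobi p q r))
    (fun p q => by
      have e : freeTwist K a (p * q) - freeTwist K a p * freeTwist K a q = 0 := by
        rw [map_mul, sub_self]
      exact (congrArg (· ∈ freeIdeal K a) e).mpr (Submodule.zero_mem _))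

/-- The generator of the free Hom-Lie algebra given by `x`. -/
def freeOf (x : X) : free K a := (freeIdeal K a).mkQ (FreeNonUnitalNonAssocAlgebra.of K x)

variable {K a} {L : HomLieAlgebra.{u, v} K}

/-- The non-associative algebra map extending `φ : X → L`. -/
def freeLiftAux (φ : X → L) : FreeNonUnitalNonAssocAlgebra K X →ₙₐ[K] BracketRing L :=
  FreeNonUnitalNonAssocAlgebra.lift K (A := BracketRing L) φ

theorem freeLiftAux_of (φ : X → L) (x : X) :
    freeLiftAux φ (FreeNonUnitalNonAssocAlgebra.of K x) = φ x :=
  FreeNonUnitalNonAssocAlgebra.lift_of_apply (A := BracketRing L) K φ x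

theorem freeLiftAux_twist (φ : X → L) (h : ∀ x, φ (a x) = L.twist (φ x))
    (p : FreeNonUnitalNonAssocAlgebra K X) :
    freeLiftAux φ (freeTwist K a p) = L.twist (freeLiftAux φ p) := by
  let T : BracketRing L →ₙₐ[K] BracketRing L :=
    { toFun := L.twist
      map_smul' := fun c x => L.twist.map_smul c x
      map_zero' := L.twist.map_zero
      map_add' := L.twist.map_add
      map_mul' := L.twist_bracket }
  have e : (freeLiftAux φ).comp (freeTwist K a) = T.comp (freeLiftAux φ) := by
    refine FreeNonUnitalNonAssocAlgebra.hom_ext K (fun x => ?_)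
    rw [NonUnitalAlgHom.comp_apply, NonUnitalAlgHom.comp_apply, freeTwist,
      FreeNonUnitalNonAssocAlgebra.lift_of_apply, freeLiftAux_of, freeLiftAux_of]
    exact h x
  exact congrArg (fun g => g p) e

theorem freeLiftAux_freeRel (φ : X → L) (h : ∀ x, φ (a x) = L.twist (φ x))
    (p : FreeNonUnitalNonAssocAlgebra K X) (hp : FreeRel K a p) : freeLiftAux φ p = 0 := by
  induction hp with
  | mul_self p => rw [map_mul]; exact L.bracket_self _
  | jacobi p q r =>
    simp only [map_add, map_mul, freeLiftAux_twist φ h]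
    exact L.hom_jacobi _ _ _
  | mul_left p q _ ih => rw [map_mul, ih, mul_zero]
  | mul_right p q _ ih => rw [map_mul, ih, zero_mul]

/-- The homomorphism from the free Hom-Lie algebra extending an equivariant map `φ : X → L`. -/
def freeLift (φ : X → L) (h : ∀ x, φ (a x) = L.twist (φ x)) : Hom (free K a) L where
  toLinearMap := (freeIdeal K a).liftQ
    (freeLiftAux φ : FreeNonUnitalNonAssocAlgebra K X →ₗ[K] BracketRing L)
    (Submodule.span_le.mpr (fun p hp => freeLiftAux_freeRel φ h p hp))
  map_bracket := by rintro ⟨p⟩ ⟨q⟩; exact map_mul (freeLiftAux φ) p q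
  map_twist := by rintro ⟨p⟩; exact freeLiftAux_twist φ h p

theorem freeLift_of (φ : X → L) (h : ∀ x, φ (a x) = L.twist (φ x)) (x : X) :
    freeLift φ h (freeOf K a x) = φ x := freeLiftAux_of φ x

theorem free_hom_ext (f g : Hom (free K a) L) (h : ∀ x, f (freeOf K a x) = g (freeOf K a x)) :
    ∀ p, f p = g p := by
  let toAlg : Hom (free K a) L → (FreeNonUnitalNonAssocAlgebra K X →ₙₐ[K] BracketRing L) :=
    fun f =>
    { toFun := fun p => f ((freeIdeal K a).mkQ p)
      map_smul' := fun c p => f.toLinearMap.map_smul c ((freeIdeal K a).mkQ p)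
      map_zero' := f.toLinearMap.map_zero
      map_add' := fun p q =>
        f.toLinearMap.map_add ((freeIdeal K a).mkQ p) ((freeIdeal K a).mkQ q)
      map_mul' := fun p q => f.map_bracket ((freeIdeal K a).mkQ p) ((freeIdeal K a).mkQ q) }
  have e : toAlg f = toAlg g := FreeNonUnitalNonAssocAlgebra.hom_ext K h
  rintro ⟨p⟩
  exact congrArg (fun g => g p) e

end Free

section Schur

variable {L : HomLieAlgebra.{u, v} K} {M : HomLieAlgebra.{u, w} K}

/-- For a homomorphism `ρ : F → L` with kernel `R`, the quotient `(R ∩ [F, F]) / [F, R]`. -/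
def multiplierOf {F : HomLieAlgebra.{u, x} K} (ρ : Hom F L) : HomLieAlgebra.{u, x} K :=
  (ρ.ker ⊓ commutator ⊤).toHomLie.quotient
    ((commutator ρ.ker).comap (ρ.ker ⊓ commutator ⊤).incl)

/-- The map `(R ∩ [F, F]) / [F, R] → (R' ∩ [F', F']) / [F', R']` induced by a homomorphism
`g : F → F'` lying over `f : L → M`. -/
def multiplierOfMap {F : HomLieAlgebra.{u, x} K} {F' : HomLieAlgebra.{u, y} K}
    (ρ : Hom F L) (ρ' : Hom F' M) (f : Hom L M) (g : Hom F F')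
    (h : ∀ p, ρ' (g p) = f (ρ p)) : Hom (multiplierOf ρ) (multiplierOf ρ') :=
  have hker : ρ.ker ≤ ρ'.ker.comap g := fun p hp => by
    have hp' : ρ p = 0 := hp
    have e : ρ' (g p) = 0 := by rw [h, hp', map_zero]
    exact e
  have hcomm : ∀ (I : HomIdeal F) (J : HomIdeal F'), I ≤ J.comap g →
      commutator I ≤ (commutator J).comap g := fun I J hIJ => by
    refine Submodule.span_le.mpr ?_
    rintro _ ⟨p, q, hq, rfl⟩
    have e : g (F.bracket p q) ∈ (commutator J).toSubmodule := by
      rw [g.map_bracket]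
      exact Submodule.subset_span ⟨_, _, hIJ hq, rfl⟩
    exact e
  quotientMap _ _ (g.restrict (ρ.ker ⊓ commutator ⊤) (ρ'.ker ⊓ commutator ⊤)
      (fun _ hp => ⟨hker hp.1, hcomm ⊤ ⊤ (fun _ _ => trivial) hp.2⟩))
    (fun _ hp => hcomm ρ.ker ρ'.ker hker hp)

theorem Hom.map_iterate_twist (f : Hom L M) (k : ℕ) (l : L) :
    f ((L.twist ^ k) l) = (M.twist ^ k) (f l) := by
  induction k with
  | zero => rfl
  | succ k ih => rw [pow_succ', pow_succ', Module.End.mul_apply, Module.End.mul_apply,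
      f.map_twist, ih]

/-- The endomorphism `(n, l) ↦ (n + 1, l)` of `ℕ × L`. The free Hom-Lie algebra on the set `L` is
the free Hom-Lie algebra on the set with endomorphism `(ℕ × L, shift)`, in which `(n, l)` stands
for `α^n l`. -/
def shift (L : HomLieAlgebra.{u, v} K) : ℕ × L → ℕ × L := fun p => (p.1 + 1, p.2)

/-- The canonical free presentation of `L`, by the free Hom-Lie algebra on the underlying set. -/
def freePresentation (L : HomLieAlgebra.{u, v} K) : Hom (free K (shift L)) L :=
  freeLift (fun p => (L.twist ^ p.1) p.2) (fun p => by
    change (L.twist ^ (p.1 + 1)) p.2 = _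
    rw [pow_succ', Module.End.mul_apply])

theorem freePresentation_surjective (L : HomLieAlgebra.{u, v} K) :
    Function.Surjective (freePresentation L) := fun l =>
  ⟨freeOf K (shift L) (0, l), freeLift_of _ _ _⟩

/-- The homomorphism between the canonical free presentations induced by `f`. -/
def freePresentationMap (f : Hom L M) : Hom (free K (shift L)) (free K (shift M)) :=
  freeLift (fun p => freeOf K (shift M) (p.1, f p.2)) (fun p => by
    change _ = (freeIdeal K (shift M)).mkQ (freeTwist K (shift M) _)
    rw [freeTwist, FreeNonUnitalNonAssocAlgebra.lift_of_apply]
    rfl)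

theorem freePresentation_of (L : HomLieAlgebra.{u, v} K) (p : ℕ × L) :
    freePresentation L (freeOf K (shift L) p) = (L.twist ^ p.1) p.2 := freeLift_of _ _ p

theorem freePresentationMap_of (f : Hom L M) (p : ℕ × L) :
    freePresentationMap f (freeOf K (shift L) p) = freeOf K (shift M) (p.1, f p.2) :=
  freeLift_of _ _ p

theorem freePresentationMap_comm (f : Hom L M) (p : free K (shift L)) :
    freePresentation M (freePresentationMap f p) = f (freePresentation L p) := by
  have key : ∀ q : ℕ × L, ((freePresentation M).comp (freePresentationMap f))
      (freeOf K (shift L) q) = (f.comp (freePresentation L)) (freeOf K (shift L) q) := by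
    intro q
    have h1 : ((freePresentation M).comp (freePresentationMap f)) (freeOf K (shift L) q)
        = (M.twist ^ q.1) (f q.2) :=
      (congrArg (freePresentation M) (freePresentationMap_of f q)).trans (freePresentation_of M _)
    have h2 : (f.comp (freePresentation L)) (freeOf K (shift L) q)
        = f ((L.twist ^ q.1) q.2) := congrArg f (freePresentation_of L q)
    rw [h1, h2, f.map_iterate_twist]
  have h := free_hom_ext ((freePresentation M).comp (freePresentationMap f))
    (f.comp (freePresentation L)) key p
  rwa [Hom.comp_apply, Hom.comp_apply] at h

/-- The Schur multiplier `(R ∩ [F, F]) / [F, R]`, for the canonical free presentation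
`0 → R → F → L → 0`. -/
def schurMultiplier (L : HomLieAlgebra.{u, v} K) : HomLieAlgebra.{u, max u v} K :=
  multiplierOf (freePresentation L)

/-- The canonical homomorphism between Schur multipliers induced by `f : L → M`. -/
def schurMap (f : Hom L M) : Hom (schurMultiplier L) (schurMultiplier M) :=
  multiplierOfMap (freePresentation L) (freePresentation M) f (freePresentationMap f)
    (freePresentationMap_comm f)

end Schur

/-! ### The epicentre -/

section Epicentre

/-- `f : G → L` is a central extension: it is surjective and `[ker f, G] = 0`. -/
def Hom.IsCentralExtension {G : HomLieAlgebra.{u, w} K} {L : HomLieAlgebra.{u, v} K}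
    (f : Hom G L) : Prop :=
  Function.Surjective f ∧ ∀ x ∈ f.ker, ∀ y : G, G.bracket x y = 0

/-- The epicentre of `L`: the intersection of the images `f(Z(G))` over all central extensions
`f : G → L`. -/
def epicentre (L : HomLieAlgebra.{u, v} K) : HomIdeal L where
  toSubmodule := ⨅ (G : HomLieAlgebra.{u, max u v} K) (f : Hom G L) (_ : f.IsCentralExtension),
    G.centre.toSubmodule.map f.toLinearMap
  twist_mem x hx := by
    simp only [Submodule.mem_iInf] at hx ⊢
    intro G f hf
    obtain ⟨z, hz, rfl⟩ := hx G f hf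
    exact ⟨G.twist z, G.centre.twist_mem z hz, f.map_twist z⟩
  bracket_mem x hx y := by
    simp only [Submodule.mem_iInf] at hx ⊢
    intro G f hf
    obtain ⟨z, hz, rfl⟩ := hx G f hf
    obtain ⟨y, rfl⟩ := hf.1 y
    exact ⟨G.bracket z y, G.centre.bracket_mem z hz y, f.map_bracket z y⟩

end Epicentre

end

end HomLieAlgebra

namespace HomLieAlgebra

noncomputable section

variable {K : Type u} [Field K]

/-! Everything rests on two facts about the exterior square.

Right exactness (`ker_exteriorMap_le`): for surjective `f`, the kernel of `f ⋏ f` is spanned by the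
elements `x ⋏ y` with `x ∈ ker f`. Hence `f ⋏ f` is injective exactly when `ker f` lies in the
exterior centre; for `f = π : L → L/N` this reads `N ≤ L.exteriorCentre`.

Hopf formula (`IsPerfect.exteriorMap_freePresentation_eq_zero_iff`): let `ρ : F → L` be the
canonical free presentation, `R = ker ρ`, and let `θ` denote the bracket map of an exterior square.
If `L` is perfect, `θ : L ⋏ L → L` is onto, so `ρ` lifts to `ψ : F → L ⋏ L` by freeness. Since `[s,
t] = θ s ⋏ θ t` in `L ⋏ L`, one gets `ψ [p, q] = ρ p ⋏ ρ q`, that is `ρ ⋏ ρ = ψ ∘ θ`, and `ψ` kills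
`[F, R]`. This gives `L ⋏ L ≅ [F, F]/[F, R]`, under which the Schur multiplier becomes `ker θ`,
naturally in `L`.

For (a), the map of multipliers is therefore the restriction of `π ⋏ π` to `ker θ`. When `N` is
central, the generators `x ⋏ y`, `x ∈ N`, of `ker (π ⋏ π)` already lie in `ker θ`, so injectivity on
multipliers, injectivity of `π ⋏ π` and `N ≤ L.exteriorCentre` are the same condition. The exterior
centre is thus itself the largest such `N`.

For (b), if `f : G → L` is central, `θ` on `G ⋏ G` kills `ker (f ⋏ f)` by right exactness, so
preimages of exterior-central elements are central in `G`. Conversely, the single central extension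
`F/[F, R] → L` detects the exterior centre, by the Hopf formula. -/

/-! ### The exterior square as a quotient of the tensor product. -/

/-- The linear map `L ⊗ L → L ⋏ L`. -/
def tensorToExterior (L : HomLieAlgebra.{u, v} K) : L ⊗[K] L →ₗ[K] exteriorSquare L :=
  (proj (box L)).toLinearMap ∘ₗ (tensorRel L).mkQ

theorem tensorToExterior_tmul {L : HomLieAlgebra.{u, v} K} (m n : L) :
    tensorToExterior L (m ⊗ₜ n) = wedge m n := rfl

theorem tensorToExterior_surjective (L : HomLieAlgebra.{u, v} K) :
    Function.Surjective (tensorToExterior L) :=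
  (Submodule.mkQ_surjective _).comp (Submodule.mkQ_surjective _)

theorem tensorRel_le_ker_tensorToExterior (L : HomLieAlgebra.{u, v} K) :
    tensorRel L ≤ LinearMap.ker (tensorToExterior L) := fun t ht => by
  have h : (tensorRel L).mkQ t = (0 : tensorSquare L) := (Submodule.Quotient.mk_eq_zero _).mpr ht
  exact (congrArg (proj (box L)) h).trans (map_zero _)

theorem wedge_self {L : HomLieAlgebra.{u, v} K} (m : L) : wedge m m = 0 :=
  (Submodule.Quotient.mk_eq_zero _).mpr (Submodule.subset_span ⟨m, m, rfl, rfl⟩)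

theorem wedge_add_right {L : HomLieAlgebra.{u, v} K} (x a b : L) :
    wedge x (a + b) = wedge x a + wedge x b := by
  simp only [← tensorToExterior_tmul, TensorProduct.tmul_add, map_add]

theorem wedge_skew {L : HomLieAlgebra.{u, v} K} (m n : L) : wedge m n = -wedge n m := by
  have h := wedge_self (m + n)
  rw [wedge_add_left, wedge_add_right, wedge_add_right, wedge_self, wedge_self, zero_add,
    add_zero] at h
  exact eq_neg_of_add_eq_zero_left h

/-- The two successive quotients, by `D(L, L)` and by the squares `m ⋆ m`, merge into one, so that
kernels can be computed inside `L ⊗ L`. -/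
theorem ker_tensorToExterior (L : HomLieAlgebra.{u, v} K) :
    LinearMap.ker (tensorToExterior L)
      = tensorRel L ⊔ Submodule.span K {t | ∃ m : L, t = m ⊗ₜ[K] m} := by
  apply le_antisymm
  · intro t ht
    have h : (tensorRel L).mkQ t ∈ (box L).toSubmodule :=
      (Submodule.Quotient.mk_eq_zero _).mp ht
    have e : (box L).toSubmodule
        ≤ (Submodule.span K {t | ∃ m : L, t = m ⊗ₜ[K] m}).map (tensorRel L).mkQ := by
      refine Submodule.span_le.mpr ?_
      rintro _ ⟨m, _, rfl, rfl⟩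
      exact ⟨m ⊗ₜ m, Submodule.subset_span ⟨m, rfl⟩, rfl⟩
    obtain ⟨s, hs, hst⟩ := e h
    have h' : t - s ∈ tensorRel L := (Submodule.Quotient.eq _).mp hst.symm
    rw [← sub_add_cancel t s]
    exact Submodule.add_mem_sup h' hs
  · refine sup_le (tensorRel_le_ker_tensorToExterior L) (Submodule.span_le.mpr ?_)
    rintro _ ⟨m, rfl⟩
    exact wedge_self m

/-- Two linear maps on `L ⋏ L` agreeing on the elements `m ⋏ n` are equal. -/
theorem exteriorSquare_hom_ext {L : HomLieAlgebra.{u, v} K} {V : Type w} [AddCommGroup V]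
    [Module K V] {S T : exteriorSquare L →ₗ[K] V} (h : ∀ m n, S (wedge m n) = T (wedge m n)) :
    S = T := by
  have e : S ∘ₗ tensorToExterior L = T ∘ₗ tensorToExterior L := TensorProduct.ext' h
  ext t
  obtain ⟨t, rfl⟩ := tensorToExterior_surjective L t
  exact LinearMap.congr_fun e t

/-! ### Functoriality and right exactness. -/

section Map

variable {L : HomLieAlgebra.{u, v} K} {M : HomLieAlgebra.{u, w} K}

theorem exteriorMap_tensorToExterior (f : Hom L M) (t : L ⊗[K] L) :
    exteriorMap f (tensorToExterior L t)
      = tensorToExterior M (TensorProduct.map f.toLinearMap f.toLinearMap t) := rfl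

theorem exteriorMap_surjective (f : Hom L M) (hf : Function.Surjective f) :
    Function.Surjective (exteriorMap f) := fun s => by
  obtain ⟨s, rfl⟩ := tensorToExterior_surjective M s
  obtain ⟨t, rfl⟩ := TensorProduct.map_surjective (g := f.toLinearMap) (g' := f.toLinearMap) hf hf s
  exact ⟨_, exteriorMap_tensorToExterior f t⟩

theorem exteriorTheta_exteriorMap (f : Hom L M) (t : exteriorSquare L) :
    exteriorTheta M (exteriorMap f t) = f (exteriorTheta L t) :=
  LinearMap.congr_fun (f := (exteriorTheta M).toLinearMap ∘ₗ (exteriorMap f).toLinearMap)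
    (g := f.toLinearMap ∘ₗ (exteriorTheta L).toLinearMap)
    (exteriorSquare_hom_ext fun m n => (f.map_bracket m n).symm) t

/-- Each defining relation is a formula in elements of the algebra, so lifting those elements along
`f` lifts the relation. -/
theorem tensorRel_le_map (f : Hom L M) (hf : Function.Surjective f) :
    tensorRel M ≤ (tensorRel L).map (TensorProduct.map f.toLinearMap f.toLinearMap) := by
  refine Submodule.span_le.mpr ?_
  rintro t ((((⟨m, m', n, rfl⟩ | ⟨m, n, n', rfl⟩) | ⟨m, n, rfl⟩) | ⟨m, m', n, n', rfl⟩) |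
      ⟨m, m', m'', n, n', n'', rfl⟩)
  · obtain ⟨m, rfl⟩ := hf m
    obtain ⟨m', rfl⟩ := hf m'
    obtain ⟨n, rfl⟩ := hf n
    exact ⟨_, Submodule.subset_span (Or.inl (Or.inl (Or.inl (Or.inl ⟨m, m', n, rfl⟩)))),
      by simp [f.map_bracket, f.map_twist]⟩
  · obtain ⟨m, rfl⟩ := hf m
    obtain ⟨n, rfl⟩ := hf n
    obtain ⟨n', rfl⟩ := hf n'
    exact ⟨_, Submodule.subset_span (Or.inl (Or.inl (Or.inl (Or.inr ⟨m, n, n', rfl⟩)))),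
      by simp [f.map_bracket, f.map_twist]⟩
  · obtain ⟨m, rfl⟩ := hf m
    obtain ⟨n, rfl⟩ := hf n
    exact ⟨_, Submodule.subset_span (Or.inl (Or.inl (Or.inr ⟨m, n, rfl⟩))),
      by simp [f.map_bracket]⟩
  · obtain ⟨m, rfl⟩ := hf m
    obtain ⟨m', rfl⟩ := hf m'
    obtain ⟨n, rfl⟩ := hf n
    obtain ⟨n', rfl⟩ := hf n'
    exact ⟨_, Submodule.subset_span (Or.inl (Or.inr ⟨m, m', n, n', rfl⟩)),
      by simp [f.map_bracket]⟩
  · obtain ⟨m, rfl⟩ := hf m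
    obtain ⟨m', rfl⟩ := hf m'
    obtain ⟨m'', rfl⟩ := hf m''
    obtain ⟨n, rfl⟩ := hf n
    obtain ⟨n', rfl⟩ := hf n'
    obtain ⟨n'', rfl⟩ := hf n''
    exact ⟨_, Submodule.subset_span (Or.inr ⟨m, m', m'', n, n', n'', rfl⟩),
      by simp [f.map_bracket, f.map_twist]⟩

/-- Right exactness of the exterior square: for surjective `f`, the kernel of `f ⋏ f` lies in
every subspace containing all `x ⋏ y` with `x ∈ ker f`. -/
theorem ker_exteriorMap_le (f : Hom L M) (hf : Function.Surjective f)
    (J : Submodule K (exteriorSquare L)) (hJ : ∀ x y : L, f x = 0 → wedge x y ∈ J) :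
    (exteriorMap f).ker.toSubmodule ≤ J := by
  intro t ht
  obtain ⟨t, rfl⟩ := tensorToExterior_surjective L t
  have ht' : TensorProduct.map f.toLinearMap f.toLinearMap t
      ∈ LinearMap.ker (tensorToExterior M) := ht
  -- All relations of `M ⋏ M`, squares included, lift to relations of `L ⋏ L`.
  have hle : LinearMap.ker (tensorToExterior M)
      ≤ (LinearMap.ker (tensorToExterior L)).map
        (TensorProduct.map f.toLinearMap f.toLinearMap) := by
    rw [ker_tensorToExterior M]
    refine sup_le ((tensorRel_le_map f hf).trans
      (Submodule.map_mono (tensorRel_le_ker_tensorToExterior L))) (Submodule.span_le.mpr ?_)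
    rintro _ ⟨m, rfl⟩
    obtain ⟨m, rfl⟩ := hf m
    exact ⟨m ⊗ₜ m, wedge_self m, rfl⟩
  obtain ⟨s, hs, hst⟩ := hle ht'
  have hs' : tensorToExterior L s = 0 := hs
  -- Correcting `t` by the relation `s` does not change its class in `L ⋏ L`, and moves it into `ker
  -- (f ⊗ f) = L ⊗ ker f + ker f ⊗ L`, by right exactness of the tensor product.
  have hk : t - s ∈ LinearMap.ker (TensorProduct.map f.toLinearMap f.toLinearMap) := by
    rw [LinearMap.mem_ker, map_sub, hst, sub_self]
  have hex : Function.Exact (LinearMap.ker f.toLinearMap).subtype f.toLinearMap :=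
    LinearMap.exact_subtype_ker_map f.toLinearMap
  rw [TensorProduct.map_ker hex hf hex hf] at hk
  have hmem : LinearMap.range ((LinearMap.ker f.toLinearMap).subtype.lTensor L)
      ⊔ LinearMap.range ((LinearMap.ker f.toLinearMap).subtype.rTensor L)
      ≤ J.comap (tensorToExterior L) := by
    refine sup_le ?_ ?_
    · rintro _ ⟨r, rfl⟩
      induction r with
      | zero => simp
      | add a b ha hb => rw [map_add]; exact add_mem ha hb
      | tmul x y =>
        change wedge x (y : L) ∈ J
        rw [wedge_skew]
        exact J.neg_mem (hJ _ _ y.2)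
    · rintro _ ⟨r, rfl⟩
      induction r with
      | zero => simp
      | add a b ha hb => rw [map_add]; exact add_mem ha hb
      | tmul x y => exact hJ _ _ x.2
  have h := hmem hk
  rwa [Submodule.mem_comap, map_sub, hs', sub_zero] at h

/-- By right exactness, injectivity means that `x ⋏ y = 0` whenever `x ∈ ker f`. The twist powers in
the exterior centre cost nothing, `ker f` being stable under the twist. -/
theorem exteriorMap_injective_iff (f : Hom L M) (hf : Function.Surjective f) :
    Function.Injective (exteriorMap f) ↔ f.ker ≤ L.exteriorCentre := by
  constructor
  · intro h x hx y k
    refine (injective_iff_map_eq_zero (exteriorMap f).toLinearMap).mp h _ ?_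
    have hx' : f x = 0 := hx
    rw [exteriorMap_wedge, f.map_iterate_twist, hx', map_zero, wedge_zero_left]
  · intro h
    refine (injective_iff_map_eq_zero (exteriorMap f).toLinearMap).mpr fun t ht => ?_
    exact (Submodule.mem_bot K).mp
      (ker_exteriorMap_le f hf ⊥ (fun x y hx => (Submodule.mem_bot K).mpr (h hx y 0)) ht)

end Map

/-! ### Perfect algebras and the bracket map of the exterior square. -/

section Perfect

variable {L : HomLieAlgebra.{u, v} K}

theorem range_exteriorTheta (L : HomLieAlgebra.{u, v} K) :
    LinearMap.range (exteriorTheta L).toLinearMap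
      = (commutator (⊤ : HomIdeal L)).toSubmodule := by
  apply le_antisymm
  · rintro _ ⟨t, rfl⟩
    obtain ⟨t, rfl⟩ := tensorToExterior_surjective L t
    induction t with
    | zero => rw [map_zero, map_zero]; exact Submodule.zero_mem _
    | add a b ha hb => rw [map_add, map_add]; exact add_mem ha hb
    | tmul x y => exact Submodule.subset_span ⟨x, y, trivial, rfl⟩
  · refine Submodule.span_le.mpr ?_
    rintro _ ⟨x, y, -, rfl⟩
    exact ⟨wedge x y, rfl⟩

theorem IsPerfect.exteriorTheta_surjective (hL : L.IsPerfect) :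
    Function.Surjective (exteriorTheta L) := fun l => by
  have h : l ∈ (commutator (⊤ : HomIdeal L)).toSubmodule := by
    rw [show commutator (⊤ : HomIdeal L) = ⊤ from hL]; trivial
  rwa [← range_exteriorTheta] at h

theorem IsPerfect.of_surjective {M : HomLieAlgebra.{u, w} K} (hL : L.IsPerfect) (f : Hom L M)
    (hf : Function.Surjective f) : M.IsPerfect := by
  refine HomIdeal.ext (eq_top_iff.mpr fun m _ => ?_)
  obtain ⟨l, rfl⟩ := hf m
  obtain ⟨t, rfl⟩ := hL.exteriorTheta_surjective l
  rw [← range_exteriorTheta]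
  exact ⟨exteriorMap f t, exteriorTheta_exteriorMap f t⟩

/-- The bracket depends only on images under `θ`; in particular `ker θ` brackets to zero with
everything. -/
theorem exteriorSquare_bracket (L : HomLieAlgebra.{u, v} K) (s t : exteriorSquare L) :
    (exteriorSquare L).bracket s t = wedge (exteriorTheta L s) (exteriorTheta L t) := by
  obtain ⟨⟨s⟩⟩ := s
  obtain ⟨⟨t⟩⟩ := t
  rfl

/-! ### The Hopf formula and maps of Schur multipliers. -/

/-- The canonical free presentation of a perfect `L` factors through `θ : L ⋏ L → L`. -/
theorem IsPerfect.exists_lift_freePresentation (hL : L.IsPerfect) :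
    ∃ ψ : Hom (free K (shift L)) (exteriorSquare L),
      ∀ p, exteriorTheta L (ψ p) = freePresentation L p := by
  choose c hc using hL.exteriorTheta_surjective
  -- The section `c` of `θ` need not commute with twists: the generator `(n, l)` stands for `α^n l`,
  -- so only the value at `(0, l)` is chosen and the others are forced.
  let ψ : Hom (free K (shift L)) (exteriorSquare L) :=
    freeLift (fun p => ((exteriorSquare L).twist ^ p.1) (c p.2)) (fun p => by
      change ((exteriorSquare L).twist ^ (p.1 + 1)) (c p.2) = _
      rw [pow_succ', Module.End.mul_apply])
  refine ⟨ψ, free_hom_ext ((exteriorTheta L).comp ψ) _ fun x => ?_⟩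
  have h : ψ (freeOf K (shift L) x) = ((exteriorSquare L).twist ^ x.1) (c x.2) :=
    freeLift_of _ _ x
  rw [Hom.comp_apply, h, freePresentation_of, Hom.map_iterate_twist, hc]

/-- For a perfect `L` with canonical free presentation `ρ : F → L` and `R = ker ρ`, the map `ρ ⋏ ρ`
has the same kernel as `F ⋏ F → F/[F, R]`; thus `L ⋏ L ≅ [F, F]/[F, R]`. -/
theorem IsPerfect.exteriorMap_freePresentation_eq_zero_iff (hL : L.IsPerfect)
    (t : exteriorSquare (free K (shift L))) :
    exteriorMap (freePresentation L) t = 0 ↔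
      exteriorTheta _ t ∈ (commutator (freePresentation L).ker).toSubmodule := by
  constructor
  · refine fun ht => ker_exteriorMap_le _ (freePresentation_surjective L)
      ((commutator (freePresentation L).ker).toSubmodule.comap (exteriorTheta _).toLinearMap)
      (fun x y hx => ?_) ht
    change (free K (shift L)).bracket x y ∈ (commutator (freePresentation L).ker).toSubmodule
    rw [bracket_skew]
    exact Submodule.neg_mem _ (Submodule.subset_span ⟨y, x, hx, rfl⟩)
  · obtain ⟨ψ, hψ⟩ := hL.exists_lift_freePresentation
    have key : ∀ x y, ψ ((free K (shift L)).bracket x y)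
        = wedge (freePresentation L x) (freePresentation L y) := fun x y => by
      rw [ψ.map_bracket, exteriorSquare_bracket, hψ, hψ]
    -- Here `ρ ⋏ ρ` factors as `ψ ∘ θ`, so it remains only to see that `ψ` kills `[F, R]`.
    have e : exteriorMap (freePresentation L) t = ψ (exteriorTheta _ t) :=
      LinearMap.congr_fun (f := (exteriorMap (freePresentation L)).toLinearMap)
        (g := ψ.toLinearMap ∘ₗ (exteriorTheta _).toLinearMap)
        (exteriorSquare_hom_ext fun m n => (key m n).symm) t
    have hle : (commutator (freePresentation L).ker).toSubmodule
        ≤ LinearMap.ker ψ.toLinearMap := by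
      refine Submodule.span_le.mpr ?_
      rintro _ ⟨x, y, hy, rfl⟩
      have hy' : freePresentation L y = 0 := hy
      change ψ _ = 0
      rw [key, hy', wedge_skew, wedge_zero_left, neg_zero]
    intro ht
    rw [e]
    exact hle ht

/-- For a homomorphism of perfect Hom-Lie algebras, injectivity on Schur multipliers is injectivity
of `f ⋏ f` on the kernel of `θ`. -/
theorem IsPerfect.schurMap_injective_iff {M : HomLieAlgebra.{u, w} K} (hL : L.IsPerfect)
    (hM : M.IsPerfect) (f : Hom L M) :
    Function.Injective (schurMap f) ↔
      ∀ s, exteriorTheta L s = 0 → exteriorMap f s = 0 → s = 0 := by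
  have hmap : ∀ t : exteriorSquare (free K (shift L)),
      exteriorMap (freePresentation M) (exteriorMap (freePresentationMap f) t)
        = exteriorMap f (exteriorMap (freePresentation L) t) := fun t =>
    LinearMap.congr_fun
      (f := (exteriorMap (freePresentation M)).toLinearMap ∘ₗ
        (exteriorMap (freePresentationMap f)).toLinearMap)
      (g := (exteriorMap f).toLinearMap ∘ₗ (exteriorMap (freePresentation L)).toLinearMap)
      (exteriorSquare_hom_ext fun m n => by
        simp only [LinearMap.comp_apply, exteriorMap_wedge, freePresentationMap_comm]) t
  -- Naturality of the Hopf formula: the Hopf criterion for `M`, applied to the image of `t` under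
  -- the map of free presentations.
  have hiff : ∀ t : exteriorSquare (free K (shift L)),
      freePresentationMap f (exteriorTheta _ t)
        ∈ (commutator (freePresentation M).ker).toSubmodule ↔
      exteriorMap f (exteriorMap (freePresentation L) t) = 0 := fun t => by
    rw [← exteriorTheta_exteriorMap, ← hM.exteriorMap_freePresentation_eq_zero_iff, hmap]
  -- Injectivity unwound to representatives in `R ∩ [F, F]`, which by `range_exteriorTheta` are
  -- values of `θ`.
  have hinj : Function.Injective (schurMap f) ↔
      ∀ p : ((freePresentation L).ker ⊓ commutator ⊤ : HomIdeal _).toSubmodule,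
        freePresentationMap f p.1 ∈ (commutator (freePresentation M).ker).toSubmodule →
        p.1 ∈ (commutator (freePresentation L).ker).toSubmodule := by
    refine (injective_iff_map_eq_zero (schurMap f).toLinearMap).trans ⟨fun h p hp => ?_, ?_⟩
    · exact (Submodule.Quotient.mk_eq_zero ((commutator (freePresentation L).ker).comap
        (HomIdeal.incl _)).toSubmodule).mp
        (h (Submodule.Quotient.mk p) ((Submodule.Quotient.mk_eq_zero _).mpr hp))
    · rintro h ⟨p⟩ hp
      exact (Submodule.Quotient.mk_eq_zero _).mpr
        (h p ((Submodule.Quotient.mk_eq_zero ((commutator (freePresentation M).ker).comap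
          (HomIdeal.incl _)).toSubmodule).mp hp))
  rw [hinj]
  constructor
  · intro h s hs hfs
    obtain ⟨t, rfl⟩ := exteriorMap_surjective _ (freePresentation_surjective L) s
    rw [exteriorTheta_exteriorMap] at hs
    have hc : exteriorTheta _ t ∈ (commutator (⊤ : HomIdeal (free K (shift L)))).toSubmodule := by
      rw [← range_exteriorTheta]; exact ⟨t, rfl⟩
    exact (hL.exteriorMap_freePresentation_eq_zero_iff t).mpr
      (h ⟨exteriorTheta _ t, hs, hc⟩ ((hiff t).mpr hfs))
  · rintro h ⟨p, hp, hc⟩ hfp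
    rw [← range_exteriorTheta] at hc
    obtain ⟨t, rfl⟩ := hc
    refine (hL.exteriorMap_freePresentation_eq_zero_iff t).mp (h _ ?_ ((hiff t).mp hfp))
    rw [exteriorTheta_exteriorMap]
    exact hp

/-! ### Quotients by central ideals. -/

theorem proj_surjective (N : HomIdeal L) : Function.Surjective (proj N) :=
  Submodule.mkQ_surjective _

theorem ker_proj (N : HomIdeal L) : (proj N).ker = N :=
  HomIdeal.ext (Submodule.ker_mkQ _)

theorem exteriorMap_proj_bijective_iff (N : HomIdeal L) :
    Function.Bijective (exteriorMap (proj N)) ↔ N ≤ L.exteriorCentre := by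
  rw [Function.Bijective, and_iff_left (exteriorMap_surjective _ (proj_surjective N)),
    exteriorMap_injective_iff _ (proj_surjective N), ker_proj]

theorem IsPerfect.schurMap_proj_injective_iff (hL : L.IsPerfect) (N : HomIdeal L)
    (hN : N ≤ L.centre) : Function.Injective (schurMap (proj N)) ↔ N ≤ L.exteriorCentre := by
  rw [hL.schurMap_injective_iff (hL.of_surjective _ (proj_surjective N))]
  constructor
  · intro h x hx y k
    -- Centrality of `N` enters here: `[α^k x, y] = 0` places `α^k x ⋏ y` in `ker θ`, where
    -- injectivity is available.
    refine h _ (hN hx y k) ?_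
    have hx' : proj N x = 0 := (Submodule.Quotient.mk_eq_zero _).mpr hx
    rw [exteriorMap_wedge, Hom.map_iterate_twist, hx', map_zero, wedge_zero_left]
  · intro h s _ hs
    exact (injective_iff_map_eq_zero (exteriorMap (proj N)).toLinearMap).mp
      ((exteriorMap_proj_bijective_iff N).mpr h).1 s hs

/-! ### The exterior centre and the epicentre. -/

theorem exteriorCentre_le_centre (L : HomLieAlgebra.{u, v} K) : L.exteriorCentre ≤ L.centre :=
  fun l hl y k => by rw [← exteriorTheta_wedge, hl, map_zero]

/-- Since `[ker f, G] = 0`, right exactness shows that `θ` on `G ⋏ G` vanishes on `ker (f ⋏ f)`. If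
`f g` is exterior-central, each `α^k g ⋏ y` lies in that kernel, so any preimage `g` is central. -/
theorem exteriorCentre_le_map_centre {G : HomLieAlgebra.{u, w} K} (f : Hom G L)
    (hf : f.IsCentralExtension) :
    L.exteriorCentre.toSubmodule ≤ G.centre.toSubmodule.map f.toLinearMap := fun l hl => by
  obtain ⟨g, rfl⟩ := hf.1 l
  refine ⟨g, fun y k => ?_, rfl⟩
  refine ker_exteriorMap_le f hf.1 (LinearMap.ker (exteriorTheta G).toLinearMap)
    (fun x y hx => hf.2 x hx y) (?_ : exteriorMap f (wedge ((G.twist ^ k) g) y) = 0)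
  rw [exteriorMap_wedge, f.map_iterate_twist]
  exact hl _ k

/-- The homomorphism `F/[F, R] → L` induced by `ρ : F → L` with kernel `R`. -/
def quotientCommutatorKer {F : HomLieAlgebra.{u, w} K} (ρ : Hom F L) :
    Hom (F.quotient (commutator ρ.ker)) L where
  toLinearMap := (commutator ρ.ker).toSubmodule.liftQ ρ.toLinearMap (Submodule.span_le.mpr (by
    rintro _ ⟨x, y, hy, rfl⟩
    exact ρ.ker.bracket_mem_left x y hy))
  map_bracket := by rintro ⟨x⟩ ⟨y⟩; exact ρ.map_bracket x y
  map_twist := by rintro ⟨x⟩; exact ρ.map_twist x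

theorem quotientCommutatorKer_proj {F : HomLieAlgebra.{u, w} K} (ρ : Hom F L) (p : F) :
    quotientCommutatorKer ρ (proj (commutator ρ.ker) p) = ρ p := rfl

theorem quotientCommutatorKer_isCentralExtension {F : HomLieAlgebra.{u, w} K} (ρ : Hom F L)
    (hρ : Function.Surjective ρ) : (quotientCommutatorKer ρ).IsCentralExtension := by
  refine ⟨fun l => ?_, ?_⟩
  · obtain ⟨p, rfl⟩ := hρ l
    exact ⟨_, quotientCommutatorKer_proj ρ p⟩
  · rintro ⟨x⟩ hx ⟨y⟩
    refine (Submodule.Quotient.mk_eq_zero _).mpr ?_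
    rw [bracket_skew]
    exact Submodule.neg_mem _ (Submodule.subset_span ⟨y, x, hx, rfl⟩)

theorem IsPerfect.exteriorCentre_eq_epicentre (hL : L.IsPerfect) :
    L.exteriorCentre = L.epicentre := by
  refine HomIdeal.ext (le_antisymm ?_ ?_)
  · exact le_iInf fun G => le_iInf fun f => le_iInf fun hf => exteriorCentre_le_map_centre f hf
  · intro l hl
    -- Only the extension `F/[F, R] → L` is needed; it lives in the universe over which the
    -- epicentre is taken.
    have hl' := (Submodule.mem_iInf _).mp ((Submodule.mem_iInf _).mp ((Submodule.mem_iInf _).mp hl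
      _) (quotientCommutatorKer (freePresentation L)))
      (quotientCommutatorKer_isCentralExtension _ (freePresentation_surjective L))
    obtain ⟨z, hz, rfl⟩ := hl'
    obtain ⟨p, rfl⟩ := proj_surjective _ z
    intro x k
    obtain ⟨q, rfl⟩ := freePresentation_surjective L x
    rw [quotientCommutatorKer_proj, ← Hom.map_iterate_twist, ← exteriorMap_wedge,
      hL.exteriorMap_freePresentation_eq_zero_iff]
    -- Centrality of the class of `p` says `[α^k p, q] ∈ [F, R]`, exactly the Hopf criterion for `ρ
    -- (α^k p) ⋏ ρ q = 0`.
    have h := hz (proj _ q) k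
    rw [← Hom.map_iterate_twist, ← Hom.map_bracket] at h
    exact (Submodule.Quotient.mk_eq_zero _).mp h

end Perfect

end

end HomLieAlgebra

theorem mainTheorem3 {K : Type u} [Field K] (L : HomLieAlgebra.{u, v} K) (hL : L.IsPerfect) :
    IsLeast {I : HomLieAlgebra.HomIdeal L | I ≤ L.centre ∧
        ∀ N : HomLieAlgebra.HomIdeal L, N ≤ L.centre →
          Function.Injective (HomLieAlgebra.schurMap (HomLieAlgebra.proj N)) → N ≤ I}
      L.exteriorCentre ∧
    (∀ N : HomLieAlgebra.HomIdeal L, N ≤ L.centre →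
      Function.Surjective (HomLieAlgebra.exteriorMap (HomLieAlgebra.proj N)) ∧
      (Function.Injective (HomLieAlgebra.schurMap (HomLieAlgebra.proj N)) ↔
        Function.Bijective (HomLieAlgebra.exteriorMap (HomLieAlgebra.proj N)))) ∧
    L.exteriorCentre = L.epicentre := by
  open HomLieAlgebra in
  refine ⟨⟨⟨exteriorCentre_le_centre L, fun N hN h =>
    (hL.schurMap_proj_injective_iff N hN).mp h⟩, fun I hI => ?_⟩, fun N hN => ⟨?_, ?_⟩, ?_⟩
  -- Minimality: the exterior centre is itself a central ideal with injective map of multipliers, so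
  -- every competitor `I` contains it.
  · exact hI.2 _ (exteriorCentre_le_centre L)
      ((hL.schurMap_proj_injective_iff _ (exteriorCentre_le_centre L)).mpr le_rfl)
  · exact exteriorMap_surjective _ (proj_surjective N)
  · rw [hL.schurMap_proj_injective_iff N hN, exteriorMap_proj_bijective_iff]
  · exact hL.exteriorCentre_eq_epicentre
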